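/- Let $a\in\mathbb C$ with $|a|<1$, let $B(z)=\left(\dfrac{z+a}{1+\bar a z}\right)^2$, let $B_n$ denote the $n$-th iterate of $B$, and put $Q=27|a|^4-18|a|^2+8\operatorname{Re}a$. Write $\mathbb D$ for the open unit disk and $\mathbb T$ for the unit circle. A fixed point $p$ of $B$ is called attracting if $|B'(p)|<1$ and non-repelling if $|B'(p)|\le 1$; its multiplicity is the order of vanishing of $B(z)-z$ at $p$. 1. If $Q<1$, then $B$ has exactly one fixed point $\alpha$ in $\mathbb D$ and exactly one fixed point in $\mathbb T$. The point $\alpha$ is attracting, the fixed point in $\mathbb T$ is not, and $B_n\to\alpha$ uniformly on every compact subset of $\mathbb D$. 2. If $Q\ge 1$, then $B$ has no fixed point in $\mathbb D$ and it has three fixed points in $\mathbb T$, counted with multiplicity; they are distinct if $Q>1$. Exactly one fixed point $p\in\mathbb T$ is non-repelling; it is attracting if $Q>1$, whereas $|B'(p)|=1$ if $Q=1$. Moreover $B_n\to p$ uniformly on every compact subset of $\mathbb D$. -/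

import Mathlib

open Complex Metric Filter Function

noncomputable section

/-- The Blaschke product `z ↦ ((z + a) / (1 + ā z)) ^ 2`. -/
def blaschkeSq (a z : ℂ) : ℂ :=
  ((z + a) / (1 + (starRingEnd ℂ) a * z)) ^ 2

/-- The quantity `27 |a|⁴ - 18 |a|² + 8 Re a`. -/
def cardioidValue (a : ℂ) : ℝ :=
  27 * ‖a‖ ^ 4 - 18 * ‖a‖ ^ 2 + 8 * a.re

/-- An attracting fixed point: a fixed point whose multiplier has modulus less than one. -/
def IsAttractingFixedPt (f : ℂ → ℂ) (p : ℂ) : Prop :=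
  DifferentiableAt ℂ f p ∧ IsFixedPt f p ∧ ‖deriv f p‖ < 1

/-- A non-repelling fixed point: a fixed point whose multiplier has modulus at most one. -/
def IsNonrepellingFixedPt (f : ℂ → ℂ) (p : ℂ) : Prop :=
  DifferentiableAt ℂ f p ∧ IsFixedPt f p ∧ ‖deriv f p‖ ≤ 1

/-- The multiplicity of `p` as a fixed point of `f`: the order of vanishing of `f z - z` at `p`
(zero if `f` is analytic at `p` and `p` is not a fixed point). -/
def fixedPtMultiplicity (f : ℂ → ℂ) (p : ℂ) : ℕ :=
  analyticOrderNatAt (fun z => f z - z) p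

/-- The iterates of `f` converge to the constant `p`, uniformly on every compact subset of the
open unit disk. -/
def IteratesTendstoOnDisk (f : ℂ → ℂ) (p : ℂ) : Prop :=
  ∀ K : Set ℂ, IsCompact K → K ⊆ ball (0 : ℂ) 1 →
    TendstoUniformlyOn (fun n : ℕ => f^[n]) (fun _ => p) atTop K

end

/-! `B` always has a fixed point `p` on the circle (`exists_isFixedPt_sphere`). Sending `p` to
infinity and the disk to the upper half-plane conjugates `B` to `halfPlaneMap`, that is `G(w) = (s -
1)/2 * (w - 1/w) + b` with `s > 1` and `b` real (`exists_param`, `blaschkeSq_toDisk_eq`). The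
multiplier at `p` has modulus `2/(s - 1)`, and the other fixed points solve `(s - 3)w² + 2bw - (s -
1) = 0`. A quarter of its discriminant is `D = b² + (s - 1)(s - 3)`, and `Q - 1` equals `(s - 3)² D`
times a positive factor (`cardioidValue_paramCoeff`).

If `Q < 1`, then `D < 0`: there are no real roots, and one root in the upper half-plane is the
interior fixed point. The pseudo-hyperbolic distance to it contracts uniformly on compact sets
(`norm_blaschkeSq_sub_div`).

If `Q ≥ 1`, then `p` can be chosen with `s ≥ 3` (`exists_param_three_le`). Then `G` increases
imaginary parts, so every orbit escapes to infinity, that is to `p`, and every real root of the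
quadratic is repelling. Multiplicities are counted on the cubic whose roots are the fixed points. -/

/-- The denominators of `blaschkeSq` do not vanish on the closed unit disk. -/
lemma one_add_conj_mul_ne_zero {a z : ℂ} (ha : ‖a‖ < 1) (hz : ‖z‖ ≤ 1) :
    1 + (starRingEnd ℂ) a * z ≠ 0 := by
  intro h
  have h1 : (starRingEnd ℂ) a * z = -1 := by linear_combination h
  have h2 : ‖a‖ * ‖z‖ = 1 := by
    have := congrArg norm h1
    simpa using this
  nlinarith [norm_nonneg a, norm_nonneg z]

/-- The basic identity for disk automorphisms. -/
lemma normSq_one_add_conj_mul_sub (a z : ℂ) :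
    normSq (1 + (starRingEnd ℂ) a * z) - normSq (z + a) =
      (1 - normSq a) * (1 - normSq z) := by
  simp only [normSq_apply, add_re, add_im, mul_re, mul_im, conj_re, conj_im, one_re, one_im]
  ring

lemma norm_add_lt_norm_one_add {a z : ℂ} (ha : ‖a‖ < 1) (hz : ‖z‖ < 1) :
    ‖z + a‖ < ‖1 + (starRingEnd ℂ) a * z‖ := by
  have h := normSq_one_add_conj_mul_sub a z
  simp only [normSq_eq_norm_sq] at h
  have h1 : 0 < (1 - ‖a‖ ^ 2) * (1 - ‖z‖ ^ 2) := by
    apply mul_pos <;> nlinarith [norm_nonneg a, norm_nonneg z]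
  exact lt_of_pow_lt_pow_left₀ 2 (norm_nonneg _) (by linarith)

lemma norm_moebius_lt_one {a z : ℂ} (ha : ‖a‖ < 1) (hz : ‖z‖ < 1) :
    ‖(z + a) / (1 + (starRingEnd ℂ) a * z)‖ < 1 := by
  rw [norm_div, div_lt_one (norm_pos_iff.2 (one_add_conj_mul_ne_zero ha hz.le))]
  exact norm_add_lt_norm_one_add ha hz

lemma norm_moebius_eq_one {a z : ℂ} (ha : ‖a‖ < 1) (hz : ‖z‖ = 1) :
    ‖(z + a) / (1 + (starRingEnd ℂ) a * z)‖ = 1 := by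
  rw [norm_div, div_eq_one_iff_eq (norm_ne_zero_iff.2 (one_add_conj_mul_ne_zero ha hz.le))]
  have h := normSq_one_add_conj_mul_sub a z
  simp only [normSq_eq_norm_sq, hz] at h
  exact (pow_left_inj₀ (norm_nonneg _) (norm_nonneg _) two_ne_zero).1 (by linarith)

lemma norm_blaschkeSq_lt_one {a z : ℂ} (ha : ‖a‖ < 1) (hz : ‖z‖ < 1) :
    ‖blaschkeSq a z‖ < 1 := by
  rw [blaschkeSq, norm_pow]
  exact pow_lt_one₀ (norm_nonneg _) (norm_moebius_lt_one ha hz) two_ne_zero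

lemma mapsTo_blaschkeSq {a : ℂ} (ha : ‖a‖ < 1) :
    Set.MapsTo (blaschkeSq a) (ball 0 1) (ball 0 1) := by
  intro z hz
  simp only [mem_ball_zero_iff] at hz ⊢
  exact norm_blaschkeSq_lt_one ha hz

/-! ### Multipliers. -/

lemma hasDerivAt_blaschkeSq {a z : ℂ} (hz : 1 + (starRingEnd ℂ) a * z ≠ 0) :
    HasDerivAt (blaschkeSq a)
      (2 * ((z + a) / (1 + (starRingEnd ℂ) a * z)) * (1 - (starRingEnd ℂ) a * a) /
        (1 + (starRingEnd ℂ) a * z) ^ 2) z := by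
  have h1 : HasDerivAt (fun z : ℂ => z + a) 1 z := (hasDerivAt_id z).add_const a
  have h2 : HasDerivAt (fun z : ℂ => 1 + (starRingEnd ℂ) a * z) ((starRingEnd ℂ) a) z := by
    simpa using ((hasDerivAt_id z).const_mul ((starRingEnd ℂ) a)).const_add 1
  have h3 := (h1.div h2 hz).pow 2
  refine h3.congr_deriv ?_
  simp only [Pi.div_apply, Nat.cast_ofNat, Nat.add_one_sub_one, pow_one, mul_div_assoc]
  congr 2
  ring

lemma norm_deriv_blaschkeSq {a z : ℂ} (ha : ‖a‖ < 1) (hz : 1 + (starRingEnd ℂ) a * z ≠ 0) :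
    ‖deriv (blaschkeSq a) z‖ =
      2 * ‖(z + a) / (1 + (starRingEnd ℂ) a * z)‖ * (1 - ‖a‖ ^ 2) /
        ‖1 + (starRingEnd ℂ) a * z‖ ^ 2 := by
  rw [(hasDerivAt_blaschkeSq hz).deriv]
  have : 1 - (starRingEnd ℂ) a * a = ((1 - ‖a‖ ^ 2 : ℝ) : ℂ) := by
    rw [conj_mul']; push_cast; rfl
  have h2 : 0 ≤ 1 - ‖a‖ ^ 2 := by nlinarith [norm_nonneg a]
  rw [this, norm_div, norm_mul, norm_mul, norm_pow, norm_real, Real.norm_of_nonneg h2]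
  simp

/-- Every fixed point in the disk is attracting. -/
lemma norm_deriv_blaschkeSq_lt_one {a α : ℂ} (ha : ‖a‖ < 1) (hα : ‖α‖ < 1)
    (hfix : IsFixedPt (blaschkeSq a) α) : ‖deriv (blaschkeSq a) α‖ < 1 := by
  have hne := one_add_conj_mul_ne_zero ha hα.le
  rw [norm_deriv_blaschkeSq ha hne]
  have hd : 0 < ‖1 + (starRingEnd ℂ) a * α‖ := norm_pos_iff.2 hne
  have hv : ‖(α + a) / (1 + (starRingEnd ℂ) a * α)‖ ^ 2 = ‖α‖ := by
    rw [← norm_pow]; exact congrArg norm hfix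
  have h := normSq_one_add_conj_mul_sub a α
  simp only [normSq_eq_norm_sq] at h
  have hv' : ‖α + a‖ = ‖(α + a) / (1 + (starRingEnd ℂ) a * α)‖ * ‖1 + (starRingEnd ℂ) a * α‖ := by
    rw [norm_div, div_mul_cancel₀ _ hd.ne']
  have hlt := norm_moebius_lt_one ha hα
  have hnn := norm_nonneg ((α + a) / (1 + (starRingEnd ℂ) a * α))
  rw [hv', ← hv] at h
  generalize ‖(α + a) / (1 + (starRingEnd ℂ) a * α)‖ = v at *
  generalize ‖1 + (starRingEnd ℂ) a * α‖ = d at *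
  have hv2 : 0 < 1 - v ^ 2 := by nlinarith
  -- With `v² = ‖α‖` the automorphism identity has the factor `1 - v⁴`; cancelling `1 - v²` turns
  -- the multiplier into `2v/(1 + v²)`.
  have h' : d ^ 2 = (1 - ‖a‖ ^ 2) * (1 + v ^ 2) := by
    apply mul_left_cancel₀ hv2.ne'
    linear_combination h
  have ha2 : 0 < 1 - ‖a‖ ^ 2 := by nlinarith [norm_nonneg a]
  rw [div_lt_one (by positivity), h']
  nlinarith [mul_pos ha2 (show 0 < (1 - v) ^ 2 by apply pow_pos; linarith)]

lemma differentiableAt_blaschkeSq {a z : ℂ} (ha : ‖a‖ < 1) (hz : ‖z‖ ≤ 1) :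
    DifferentiableAt ℂ (blaschkeSq a) z :=
  (hasDerivAt_blaschkeSq (one_add_conj_mul_ne_zero ha hz)).differentiableAt

/-! ### From pointwise to locally uniform convergence. -/

/-- Pointwise convergence of the iterates of a holomorphic self-map of the disk is locally
uniform, by the Schwarz lemma. -/
lemma iteratesTendstoOnDisk_of_pointwise {f : ℂ → ℂ} {p : ℂ}
    (hf : DifferentiableOn ℂ f (ball 0 1)) (hmaps : Set.MapsTo f (ball 0 1) (ball 0 1))
    (hlim : ∀ z ∈ ball (0 : ℂ) 1, Tendsto (fun n => f^[n] z) atTop (nhds p)) :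
    IteratesTendstoOnDisk f p := by
  intro K hK hKD
  rw [← tendstoLocallyUniformlyOn_iff_tendstoUniformlyOn_of_compact hK,
    Metric.tendstoLocallyUniformlyOn_iff]
  intro ε hε x hx
  have hxD := hKD hx
  have hx1 : ‖x‖ < 1 := by simpa using hxD
  set r := 1 - ‖x‖ with hr
  have hr0 : 0 < r := by linarith
  have hsub : ball x r ⊆ ball (0 : ℂ) 1 := by
    apply ball_subset_ball'
    simp [hr]
  have hdiff : ∀ n, DifferentiableOn ℂ f^[n] (ball 0 1) := fun n => by
    induction n with
    | zero => exact differentiableOn_id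
    | succ n ih => exact ih.comp hf hmaps
  -- The Schwarz lemma bounds the distortion from the centre `x` of every iterate by `2 / r`; the
  -- radius `ε * r / 4` makes this contribution `ε / 2`.
  set δ := min r (ε * r / 4) with hδ
  have hδ0 : 0 < δ := lt_min hr0 (by positivity)
  refine ⟨ball x δ, mem_nhdsWithin_of_mem_nhds (ball_mem_nhds x hδ0), ?_⟩
  filter_upwards [Metric.tendsto_nhds.1 (hlim x hxD) (ε / 2) (by positivity)] with n hn y hy
  have hyr : y ∈ ball x r := ball_subset_ball (min_le_left _ _) hy
  have hmap : Set.MapsTo f^[n] (ball x r) (ball (f^[n] x) 2) := by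
    intro w hw
    have h1 : ‖f^[n] w‖ < 1 := by simpa using hmaps.iterate n (hsub hw)
    have h2 : ‖f^[n] x‖ < 1 := by simpa using hmaps.iterate n hxD
    rw [mem_ball, dist_eq_norm]
    linarith [norm_sub_le (f^[n] w) (f^[n] x)]
  have h3 := Complex.dist_le_div_mul_dist_of_mapsTo_ball ((hdiff n).mono hsub)
    (hmap.mono_right ball_subset_closedBall) hyr
  have h4 : dist y x < ε * r / 4 := lt_of_lt_of_le hy (min_le_right _ _)
  have h5 : 2 / r * dist y x < ε / 2 := by
    calc 2 / r * dist y x < 2 / r * (ε * r / 4) := by gcongr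
      _ = ε / 2 := by field_simp; ring
  rw [dist_comm]
  linarith [dist_triangle (f^[n] y) (f^[n] x) p]

/-! ### The parameters `s`, `b` and the half-plane coordinate. -/

/-- The parametrization of the coefficients `a` that have a given boundary fixed point. -/
noncomputable def paramCoeff (s b : ℝ) : ℂ := (s + b * I) * (s - 2 - b * I) / (s - b * I) ^ 2

/-- The boundary fixed point of `blaschkeSq (paramCoeff s b)` singled out by the parameters. -/
noncomputable def paramFixedPt (s b : ℝ) : ℂ := ((s + b * I) / (s - b * I)) ^ 2

/-- A Möbius map from the upper half-plane onto the unit disk, sending `∞` to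
`paramFixedPt s b`. -/
noncomputable def toDisk (s b : ℝ) (w : ℂ) : ℂ :=
  paramFixedPt s b * ((w - (b + (s - 1) * I)) / (w - (b - (s - 1) * I)))

/-- The map of the upper half-plane conjugate to `blaschkeSq (paramCoeff s b)`. -/
noncomputable def halfPlaneMap (s b : ℝ) (w : ℂ) : ℂ := (s - 1) / 2 * (w - 1 / w) + b

section
variable {s b : ℝ}

lemma ofReal_sub_mul_I_ne_zero (hs : 1 < s) : (s : ℂ) - b * I ≠ 0 := by
  intro h
  have := congrArg re h
  simp at this
  linarith

lemma ofReal_add_mul_I_ne_zero (hs : 1 < s) : (s : ℂ) + b * I ≠ 0 := by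
  intro h
  have := congrArg re h
  simp at this
  linarith

lemma conj_ofReal_sub_mul_I : (starRingEnd ℂ) ((s : ℂ) - b * I) = s + b * I := by
  simp

lemma norm_paramFixedPt (hs : 1 < s) : ‖paramFixedPt s b‖ = 1 := by
  rw [paramFixedPt, norm_pow, norm_div, ← conj_ofReal_sub_mul_I, norm_conj,
    div_self (norm_ne_zero_iff.2 (ofReal_sub_mul_I_ne_zero hs)), one_pow]

lemma paramFixedPt_ne_zero (hs : 1 < s) : paramFixedPt s b ≠ 0 := by
  rw [← norm_ne_zero_iff, norm_paramFixedPt hs]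
  exact one_ne_zero

lemma conj_paramCoeff :
    (starRingEnd ℂ) (paramCoeff s b) = (s - b * I) * (s - 2 + b * I) / (s + b * I) ^ 2 := by
  simp [paramCoeff, sub_eq_add_neg, map_ofNat]

lemma normSq_ofReal_sub_mul_I : normSq ((s : ℂ) - b * I) = s ^ 2 + b ^ 2 := by
  simp [normSq_apply]; ring

lemma norm_sq_paramCoeff (hs : 1 < s) :
    ‖paramCoeff s b‖ ^ 2 = ((s - 2) ^ 2 + b ^ 2) / (s ^ 2 + b ^ 2) := by
  have h : 0 < s ^ 2 + b ^ 2 := by positivity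
  rw [← normSq_eq_norm_sq, paramCoeff, map_div₀, map_mul, map_pow, ← conj_ofReal_sub_mul_I,
    normSq_conj, normSq_ofReal_sub_mul_I]
  have : normSq ((s : ℂ) - 2 - b * I) = (s - 2) ^ 2 + b ^ 2 := by
    simp [normSq_apply]; ring
  rw [this]
  field_simp

lemma one_sub_norm_sq_paramCoeff (hs : 1 < s) :
    1 - ‖paramCoeff s b‖ ^ 2 = 4 * (s - 1) / (s ^ 2 + b ^ 2) := by
  have h : 0 < s ^ 2 + b ^ 2 := by positivity
  rw [norm_sq_paramCoeff hs]
  field_simp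
  ring

lemma re_paramCoeff (hs : 1 < s) :
    (paramCoeff s b).re =
      ((s ^ 3 - 3 * s * b ^ 2) * (s - 2) + b * (3 * s ^ 2 * b - b ^ 3)) / (s ^ 2 + b ^ 2) ^ 2 := by
  have h1 := ofReal_sub_mul_I_ne_zero (b := b) hs
  have h2 := ofReal_add_mul_I_ne_zero (b := b) hs
  have hN : (((s ^ 2 + b ^ 2) ^ 2 : ℝ) : ℂ) = ((s + b * I) * (s - b * I)) ^ 2 := by
    push_cast
    rw [show (s + b * I) * (s - b * I) = (s ^ 2 + b ^ 2 : ℂ) by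
      linear_combination -(b : ℂ) ^ 2 * I_sq]
  have : paramCoeff s b = (s + b * I) ^ 3 * (s - 2 - b * I) / ((s ^ 2 + b ^ 2) ^ 2 : ℝ) := by
    rw [hN, paramCoeff]
    field_simp
  rw [this, div_ofReal_re]
  congr 1
  simp [pow_succ]
  ring

/-- The last factor of the numerator is a quarter of the discriminant of the quadratic for the
remaining fixed points. The factor `(s - 3) ^ 2` records that `Q = 1` when the multiplier at the
distinguished point has modulus one. -/
lemma cardioidValue_paramCoeff (hs : 1 < s) :
    cardioidValue (paramCoeff s b) - 1 =
      16 * (s - 3) ^ 2 * (b ^ 2 + (s - 1) * (s - 3)) / (s ^ 2 + b ^ 2) ^ 2 := by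
  have h : 0 < s ^ 2 + b ^ 2 := by positivity
  rw [cardioidValue, show ‖paramCoeff s b‖ ^ 4 = (‖paramCoeff s b‖ ^ 2) ^ 2 by ring,
    norm_sq_paramCoeff hs, re_paramCoeff hs]
  field_simp
  ring

lemma im_sub_ne_zero (hs : 1 < s) {w : ℂ} (hw : 0 ≤ w.im) : w - (b - (s - 1) * I) ≠ 0 := by
  intro h
  have := congrArg im h
  simp at this
  linarith

lemma add_I_ne_zero {w : ℂ} (hw : 0 ≤ w.im) : w + I ≠ 0 := by
  intro h
  have := congrArg im h
  simp at this
  linarith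

/-- Together with `toDisk_add`, this makes the Möbius factor of `B` a unimodular multiple of `(w -
I) / (w + I)`: the coordinate puts the critical point `-a` at `I`. -/
lemma one_add_conj_mul_toDisk (hs : 1 < s) {w : ℂ} (hw : w - (b - (s - 1) * I) ≠ 0) :
    1 + (starRingEnd ℂ) (paramCoeff s b) * toDisk s b w =
      2 * (s - 1) * (w + I) / ((s - b * I) * (w - (b - (s - 1) * I))) := by
  have h1 := ofReal_sub_mul_I_ne_zero (b := b) hs
  have h2 := ofReal_add_mul_I_ne_zero (b := b) hs
  rw [conj_paramCoeff, toDisk, paramFixedPt]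
  generalize hd : w - (b - (s - 1) * I) = d at *
  have hw' : w = d + (b - (s - 1) * I) := by linear_combination hd
  subst hw'
  generalize hm : (s : ℂ) - b * I = m at *
  generalize hn : (s : ℂ) + b * I = n at *
  field_simp
  subst hm hn
  ring_nf
  simp only [I_sq]
  ring_nf

lemma toDisk_add (hs : 1 < s) {w : ℂ} (hw : w - (b - (s - 1) * I) ≠ 0) :
    toDisk s b w + paramCoeff s b =
      (s + b * I) / (s - b * I) * (2 * (s - 1) * (w - I) /
        ((s - b * I) * (w - (b - (s - 1) * I)))) := by
  have h1 := ofReal_sub_mul_I_ne_zero (b := b) hs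
  have h2 := ofReal_add_mul_I_ne_zero (b := b) hs
  rw [paramCoeff, toDisk, paramFixedPt]
  generalize hd : w - (b - (s - 1) * I) = d at *
  have hw' : w = d + (b - (s - 1) * I) := by linear_combination hd
  subst hw'
  generalize hm : (s : ℂ) - b * I = m at *
  generalize hn : (s : ℂ) + b * I = n at *
  field_simp
  subst hm hn
  ring_nf
  simp only [I_sq]
  ring_nf
end
section
variable {s b : ℝ}

lemma ofReal_sub_one_ne_zero (hs : 1 < s) : (s : ℂ) - 1 ≠ 0 := by
  have : ((s - 1 : ℝ) : ℂ) ≠ 0 := ofReal_ne_zero.2 (by linarith)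
  simpa using this

lemma blaschkeSq_toDisk (hs : 1 < s) {w : ℂ} (hw : 0 ≤ w.im) :
    blaschkeSq (paramCoeff s b) (toDisk s b w) =
      paramFixedPt s b * ((w - I) / (w + I)) ^ 2 := by
  have hd := im_sub_ne_zero (b := b) hs hw
  have hI := add_I_ne_zero hw
  have h1 := ofReal_sub_mul_I_ne_zero (b := b) hs
  have h3 := ofReal_sub_one_ne_zero hs
  rw [blaschkeSq, one_add_conj_mul_toDisk hs hd, toDisk_add hs hd, paramFixedPt, ← mul_pow]
  congr 1
  generalize w - (b - (s - 1) * I) = d at *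
  generalize (s : ℂ) - b * I = m at *
  generalize (s : ℂ) - 1 = t at *
  field_simp

/-- The fixed points of the Blaschke product in the half-plane coordinate. -/
lemma isFixedPt_toDisk_iff (hs : 1 < s) {w : ℂ} (hw : 0 ≤ w.im) :
    IsFixedPt (blaschkeSq (paramCoeff s b)) (toDisk s b w) ↔
      (s - 3) * w ^ 2 + 2 * b * w - (s - 1) = 0 := by
  have hd := im_sub_ne_zero (b := b) hs hw
  have hI := add_I_ne_zero hw
  -- This formula for `B`, unlike `halfPlaneMap`, is still valid at `w = 0`, so real `w` are covered
  -- as well.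
  rw [IsFixedPt, blaschkeSq_toDisk hs hw, toDisk, mul_right_inj' (paramFixedPt_ne_zero hs),
    div_pow, div_eq_div_iff (pow_ne_zero 2 hI) hd]
  constructor
  · intro h
    have : 2 * I * ((s - 3) * w ^ 2 + 2 * b * w - (s - 1)) = 0 := by
      linear_combination h - (2 * s - 2) * I * I_sq
    simpa using this
  · intro h
    linear_combination 2 * I * h + (2 * s - 2) * I * I_sq

lemma im_halfPlaneMap (w : ℂ) :
    (halfPlaneMap s b w).im = (s - 1) / 2 * (w.im + w.im / normSq w) := by
  have : ((s : ℂ) - 1) / 2 = (((s - 1) / 2 : ℝ) : ℂ) := by push_cast; rfl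
  rw [halfPlaneMap, this, one_div, add_im, im_ofReal_mul, sub_im, inv_im, ofReal_im]
  ring

lemma im_halfPlaneMap_pos (hs : 1 < s) {w : ℂ} (hw : 0 < w.im) : 0 < (halfPlaneMap s b w).im := by
  rw [im_halfPlaneMap]
  have : 0 ≤ normSq w := normSq_nonneg w
  have : 0 < s - 1 := by linarith
  positivity

lemma blaschkeSq_toDisk_eq (hs : 1 < s) {w : ℂ} (hw : 0 < w.im) :
    blaschkeSq (paramCoeff s b) (toDisk s b w) = toDisk s b (halfPlaneMap s b w) := by
  have hI := add_I_ne_zero hw.le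
  have hG := im_sub_ne_zero (b := b) hs (im_halfPlaneMap_pos (b := b) hs hw).le
  have hw0 : w ≠ 0 := by rintro rfl; simp at hw
  have h3 := ofReal_sub_one_ne_zero hs
  rw [blaschkeSq_toDisk hs hw.le, toDisk, mul_right_inj' (paramFixedPt_ne_zero hs),
    div_pow, div_eq_div_iff (pow_ne_zero 2 hI) hG, halfPlaneMap]
  field_simp
  ring_nf
  simp only [I_sq, I_pow_three]
  ring

lemma normSq_sub_sub_normSq_sub (w : ℂ) :
    normSq (w - (b - (s - 1) * I)) - normSq (w - (b + (s - 1) * I)) = 4 * (s - 1) * w.im := by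
  simp [normSq_apply]
  ring

lemma one_sub_norm_sq_toDisk (hs : 1 < s) {w : ℂ} (hw : w - (b - (s - 1) * I) ≠ 0) :
    1 - ‖toDisk s b w‖ ^ 2 = 4 * (s - 1) * w.im / normSq (w - (b - (s - 1) * I)) := by
  have h := normSq_pos.2 hw
  rw [toDisk, norm_mul, norm_paramFixedPt hs, one_mul, ← normSq_eq_norm_sq, map_div₀,
    ← normSq_sub_sub_normSq_sub, sub_div, div_self h.ne']

lemma norm_toDisk_lt_one (hs : 1 < s) {w : ℂ} (hw : 0 < w.im) : ‖toDisk s b w‖ < 1 := by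
  have hd := im_sub_ne_zero (b := b) hs hw.le
  have h := one_sub_norm_sq_toDisk hs hd
  have : 0 < 1 - ‖toDisk s b w‖ ^ 2 := by
    rw [h]
    have := normSq_pos.2 hd
    have : 0 < s - 1 := by linarith
    positivity
  exact lt_of_pow_lt_pow_left₀ 2 zero_le_one (by linarith)

lemma norm_toDisk_ofReal (hs : 1 < s) (x : ℝ) : ‖toDisk s b x‖ = 1 := by
  have hd := im_sub_ne_zero (b := b) (w := (x : ℂ)) hs (by simp)
  have h := one_sub_norm_sq_toDisk hs hd
  simp only [ofReal_im, mul_zero, zero_div] at h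
  exact (pow_left_inj₀ (norm_nonneg _) zero_le_one two_ne_zero).1 (by linarith)

/-- This formula stands in for the value at infinity: `toDisk` tends to the distinguished point as
`w` grows, never attains it, and is injective. -/
lemma toDisk_sub {w : ℂ} (hw : w - (b - (s - 1) * I) ≠ 0) :
    toDisk s b w - paramFixedPt s b =
      paramFixedPt s b * (-(2 * (s - 1) * I) / (w - (b - (s - 1) * I))) := by
  rw [toDisk]
  generalize hd : w - (b - (s - 1) * I) = d at *
  have : w - (b + (s - 1) * I) = d - 2 * (s - 1) * I := by rw [← hd]; ring
  rw [this]
  field_simp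
  ring

lemma toDisk_ne (hs : 1 < s) {w : ℂ} (hw : w - (b - (s - 1) * I) ≠ 0) :
    toDisk s b w ≠ paramFixedPt s b := by
  rw [← sub_ne_zero, toDisk_sub hw]
  have := ofReal_sub_one_ne_zero hs
  have := paramFixedPt_ne_zero (b := b) hs
  simp_all

lemma toDisk_injOn (hs : 1 < s) {w w' : ℂ} (hw : w - (b - (s - 1) * I) ≠ 0)
    (hw' : w' - (b - (s - 1) * I) ≠ 0) (h : toDisk s b w = toDisk s b w') : w = w' := by
  rw [← sub_left_inj (a := paramFixedPt s b), toDisk_sub hw, toDisk_sub hw',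
    mul_right_inj' (paramFixedPt_ne_zero hs), div_eq_div_iff hw hw', mul_right_inj'] at h
  · linear_combination -h
  · simpa using ofReal_sub_one_ne_zero hs

lemma exists_toDisk_eq (hs : 1 < s) {z : ℂ} (hz : z ≠ paramFixedPt s b) :
    ∃ w, w - (b - (s - 1) * I) ≠ 0 ∧ toDisk s b w = z := by
  have hp := paramFixedPt_ne_zero (b := b) hs
  have h3 := ofReal_sub_one_ne_zero hs
  have hz' : paramFixedPt s b - z ≠ 0 := sub_ne_zero.2 hz.symm
  refine ⟨paramFixedPt s b * (2 * (s - 1) * I) / (paramFixedPt s b - z) + (b - (s - 1) * I), ?_⟩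
  have hd : paramFixedPt s b * (2 * (s - 1) * I) / (paramFixedPt s b - z) + (b - (s - 1) * I) -
    (b - (s - 1) * I) ≠ 0 := by
    rw [add_sub_cancel_right]
    simp [hp, h3, hz']
  refine ⟨hd, ?_⟩
  rw [← sub_left_inj (a := paramFixedPt s b), toDisk_sub hd, add_sub_cancel_right]
  generalize (s : ℂ) - 1 = t at *
  field_simp
  ring

lemma exists_toDisk_eq_of_norm_lt (hs : 1 < s) {z : ℂ} (hz : ‖z‖ < 1) :
    ∃ w : ℂ, 0 < w.im ∧ toDisk s b w = z := by
  obtain ⟨w, hw, rfl⟩ := exists_toDisk_eq (b := b) hs (z := z) (by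
    rintro rfl; rw [norm_paramFixedPt hs] at hz; exact lt_irrefl _ hz)
  refine ⟨w, ?_, rfl⟩
  have h := one_sub_norm_sq_toDisk hs hw
  have h0 : 0 < 1 - ‖toDisk s b w‖ ^ 2 := by nlinarith [norm_nonneg (toDisk s b w)]
  have h1 := normSq_pos.2 hw
  rw [h, lt_div_iff₀ h1, zero_mul] at h0
  exact (pos_iff_pos_of_mul_pos h0).1 (by linarith)

lemma exists_toDisk_eq_of_norm_eq (hs : 1 < s) {z : ℂ} (hz : ‖z‖ = 1)
    (hzp : z ≠ paramFixedPt s b) : ∃ x : ℝ, toDisk s b x = z := by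
  obtain ⟨w, hw, rfl⟩ := exists_toDisk_eq (b := b) hs hzp
  have h := one_sub_norm_sq_toDisk hs hw
  have h1 := normSq_pos.2 hw
  have h2 : s - 1 ≠ 0 := by linarith
  rw [hz, one_pow, sub_self, eq_comm, div_eq_zero_iff] at h
  have him : w.im = 0 := by simpa [h1.ne', h2] using h
  exact ⟨w.re, by rw [show ((w.re : ℝ) : ℂ) = w from Complex.ext rfl (by simp [him])]⟩

lemma one_add_conj_mul_paramFixedPt (hs : 1 < s) :
    1 + (starRingEnd ℂ) (paramCoeff s b) * paramFixedPt s b = 2 * (s - 1) / (s - b * I) := by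
  have h1 := ofReal_sub_mul_I_ne_zero (b := b) hs
  have h2 := ofReal_add_mul_I_ne_zero (b := b) hs
  rw [conj_paramCoeff, paramFixedPt]
  generalize hm : (s : ℂ) - b * I = m at *
  generalize hn : (s : ℂ) + b * I = n at *
  field_simp
  subst hm
  ring

lemma paramFixedPt_add (hs : 1 < s) :
    paramFixedPt s b + paramCoeff s b =
      (s + b * I) / (s - b * I) * (2 * (s - 1) / (s - b * I)) := by
  have h1 := ofReal_sub_mul_I_ne_zero (b := b) hs
  rw [paramCoeff, paramFixedPt]
  generalize hm : (s : ℂ) - b * I = m at *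
  field_simp
  ring

lemma isFixedPt_paramFixedPt (hs : 1 < s) :
    IsFixedPt (blaschkeSq (paramCoeff s b)) (paramFixedPt s b) := by
  have h : (2 * (s - 1) / (s - b * I) : ℂ) ≠ 0 :=
    div_ne_zero (by simpa using ofReal_sub_one_ne_zero hs) (ofReal_sub_mul_I_ne_zero hs)
  rw [IsFixedPt, blaschkeSq, one_add_conj_mul_paramFixedPt hs, paramFixedPt_add hs,
    mul_div_cancel_right₀ _ h, paramFixedPt]

lemma norm_paramCoeff_lt_one (hs : 1 < s) : ‖paramCoeff s b‖ < 1 := by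
  have h := one_sub_norm_sq_paramCoeff (b := b) hs
  have : 0 < 4 * (s - 1) / (s ^ 2 + b ^ 2) := by
    have : 0 < s - 1 := by linarith
    positivity
  exact lt_of_pow_lt_pow_left₀ 2 zero_le_one (by linarith)

/-- The multiplier of `halfPlaneMap` at infinity is the reciprocal of its leading coefficient `(s -
1) / 2`. Hence the point is non-repelling exactly when `3 ≤ s`. -/
lemma norm_deriv_paramFixedPt (hs : 1 < s) :
    ‖deriv (blaschkeSq (paramCoeff s b)) (paramFixedPt s b)‖ = 2 / (s - 1) := by
  have ha := norm_paramCoeff_lt_one (b := b) hs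
  have hp := norm_paramFixedPt (b := b) hs
  rw [norm_deriv_blaschkeSq ha (one_add_conj_mul_ne_zero ha hp.le), norm_moebius_eq_one ha hp,
    one_sub_norm_sq_paramCoeff hs, ← normSq_eq_norm_sq, one_add_conj_mul_paramFixedPt hs,
    map_div₀, normSq_ofReal_sub_mul_I,
    show (2 * (s - 1) : ℂ) = ((2 * (s - 1) : ℝ) : ℂ) by push_cast; rfl, normSq_ofReal]
  have : 0 < s - 1 := by linarith
  have : 0 < s ^ 2 + b ^ 2 := by positivity
  field_simp
  norm_num

/-- The right-hand side is the derivative of `halfPlaneMap` at `x`. -/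
lemma norm_deriv_toDisk_ofReal (hs : 1 < s) {x : ℝ}
    (hx : (s - 3) * x ^ 2 + 2 * b * x - (s - 1) = 0) :
    ‖deriv (blaschkeSq (paramCoeff s b)) (toDisk s b x)‖ = (s - 1) / 2 * (1 + 1 / x ^ 2) := by
  have ha := norm_paramCoeff_lt_one (b := b) hs
  have hp := norm_toDisk_ofReal (b := b) hs x
  have hd := im_sub_ne_zero (b := b) (w := (x : ℂ)) hs (by simp)
  have hs0 : 0 < s - 1 := by linarith
  have hx0 : x ≠ 0 := by
    rintro rfl
    simp at hx
    linarith
  have hN : 0 < s ^ 2 + b ^ 2 := by positivity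
  have hE : normSq ((x : ℂ) - (b - (s - 1) * I)) = (x - b) ^ 2 + (s - 1) ^ 2 := by
    simp [normSq_apply]; ring
  have hI : normSq ((x : ℂ) + I) = x ^ 2 + 1 := by
    simp [normSq_apply]; ring
  rw [norm_deriv_blaschkeSq ha (one_add_conj_mul_ne_zero ha hp.le), norm_moebius_eq_one ha hp,
    one_sub_norm_sq_paramCoeff hs, ← normSq_eq_norm_sq, one_add_conj_mul_toDisk hs hd,
    show (2 * (s - 1) : ℂ) = ((2 * (s - 1) : ℝ) : ℂ) by push_cast; rfl,
    map_div₀, map_mul, map_mul, normSq_ofReal_sub_mul_I, hE, hI, normSq_ofReal]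
  have hE0 : 0 < (x - b) ^ 2 + (s - 1) ^ 2 := by positivity
  -- Square the fixed-point equation `2x(x - b) = (s - 1)(x² - 1)` and add `4(s - 1)²x²`.
  have key : ((x - b) ^ 2 + (s - 1) ^ 2) * (4 * x ^ 2) = (s - 1) ^ 2 * (x ^ 2 + 1) ^ 2 := by
    have : 2 * x * (x - b) = (s - 1) * (x ^ 2 - 1) := by linear_combination -hx
    linear_combination (2 * x * (x - b) + (s - 1) * (x ^ 2 - 1)) * this
  field_simp
  linear_combination key
end

/-! ### Finding boundary fixed points and their parameters. -/

/-- Every boundary fixed point comes from the parametrization. -/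
lemma exists_param {a p : ℂ} (ha : ‖a‖ < 1) (hp : ‖p‖ = 1) (hfix : IsFixedPt (blaschkeSq a) p) :
    ∃ s b : ℝ, 1 < s ∧ a = paramCoeff s b ∧ p = paramFixedPt s b := by
  have hne := one_add_conj_mul_ne_zero ha hp.le
  obtain ⟨u, hu⟩ : ∃ u, u = (p + a) / (1 + (starRingEnd ℂ) a * p) := ⟨_, rfl⟩
  have hu1 : ‖u‖ = 1 := by rw [hu]; exact norm_moebius_eq_one ha hp
  have hup : u ^ 2 = p := by rw [hu]; exact hfix
  have hrel : u * (1 + (starRingEnd ℂ) a * u ^ 2) = u ^ 2 + a := by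
    rw [hup, hu, div_mul_cancel₀ _ hne]
  have huu : (starRingEnd ℂ) u * u = 1 := by rw [conj_mul', hu1]; simp
  have hu0 : u ≠ 0 := by rintro rfl; simp at hu1
  have hua : u - a ≠ 0 := by
    intro h
    rw [sub_eq_zero.1 h] at hu1
    linarith
  have hcu : (starRingEnd ℂ) u = u⁻¹ := eq_inv_of_mul_eq_one_left huu
  have hua' : 1 - (starRingEnd ℂ) a * u ≠ 0 := by
    have := one_add_conj_mul_ne_zero (a := -a) (z := u) (by simpa using ha) hu1.le
    simpa [sub_eq_add_neg] using this
  -- This `c` will be `s - b * I`: it solves `a = u(c - 2)/c`, and the fixed-point equation becomes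
  -- `conj c / c = u`.
  set c : ℂ := 2 * u / (u - a) with hc
  have hcc : (starRingEnd ℂ) c = 2 / (1 - (starRingEnd ℂ) a * u) := by
    have h : u⁻¹ - (starRingEnd ℂ) a = (1 - (starRingEnd ℂ) a * u) / u := by field_simp
    rw [hc, map_div₀, map_mul, map_sub, hcu, map_ofNat, h]
    field_simp
  have h1 : ((c.re : ℝ) : ℂ) - ((-c.im : ℝ) : ℂ) * I = c := by
    apply Complex.ext <;> simp
  have h2 : ((c.re : ℝ) : ℂ) + ((-c.im : ℝ) : ℂ) * I = (starRingEnd ℂ) c := by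
    apply Complex.ext <;> simp
  have h3 : (starRingEnd ℂ) c / c = u := by
    have h : u - a = u ^ 2 * (1 - (starRingEnd ℂ) a * u) := by linear_combination hrel
    rw [hcc, hc, h]
    field_simp
  have hc0 : c ≠ 0 := div_ne_zero (by simpa using hu0) hua
  refine ⟨c.re, -c.im, ?_, ?_, ?_⟩
  -- `Re c - 1` is the Poisson kernel `(1 - |a|²)/|u - a|²`.
  · have h : c = (u + a) / (u - a) + 1 := by rw [hc]; field_simp; ring
    rw [h, add_re, one_re, lt_add_iff_pos_left, div_re, ← add_div]
    apply div_pos _ (normSq_pos.2 hua)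
    have hu2 : u.re * u.re + u.im * u.im = 1 := by
      rw [← normSq_apply, normSq_eq_norm_sq, hu1]; norm_num
    have ha2 : a.re * a.re + a.im * a.im < 1 := by
      rw [← normSq_apply, normSq_eq_norm_sq]; nlinarith [norm_nonneg a]
    simp only [add_re, sub_re, add_im, sub_im]
    nlinarith
  · have h4 : ((c.re : ℝ) : ℂ) - 2 - ((-c.im : ℝ) : ℂ) * I = c - 2 := by
      linear_combination h1
    rw [paramCoeff, h4, h1, h2, show (starRingEnd ℂ) c * (c - 2) / c ^ 2 =
      (starRingEnd ℂ) c / c * ((c - 2) / c) by field_simp, h3, hc]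
    field_simp
    ring
  · rw [paramFixedPt, h1, h2, h3, hup]

/-- There is always a fixed point on the unit circle. -/
lemma exists_isFixedPt_sphere {a : ℂ} (ha : ‖a‖ < 1) :
    ∃ p : ℂ, ‖p‖ = 1 ∧ IsFixedPt (blaschkeSq a) p := by
  have hre := abs_lt.1 (lt_of_le_of_lt (abs_re_le_norm a) ha)
  -- For `p = e⁴` with `e = exp(it)`, it suffices that `e⁴ + a = e²(1 + āe⁴)`. Dividing by `e³`,
  -- this says that `e + ae⁻³` is real, and `g` is its imaginary part; at `±π/2` it equals `±(1 + Re
  -- a)`.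
  let g : ℝ → ℝ := fun t => (a * exp (-(3 * t * I))).im + Real.sin t
  have hg : ContinuousOn g (Set.Icc (-(Real.pi / 2)) (Real.pi / 2)) := by
    apply Continuous.continuousOn
    fun_prop
  have e1 : exp (-(3 * ((Real.pi / 2 : ℝ) : ℂ) * I)) = I := by
    rw [show -(3 * ((Real.pi / 2 : ℝ) : ℂ) * I) = Real.pi / 2 * I - 2 * Real.pi * I by
      push_cast; ring, exp_sub, exp_two_pi_mul_I, exp_pi_div_two_mul_I, div_one]
  have e2 : exp (-(3 * ((-(Real.pi / 2) : ℝ) : ℂ) * I)) = -I := by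
    rw [show -(3 * ((-(Real.pi / 2) : ℝ) : ℂ) * I) = -(-(3 * ((Real.pi / 2 : ℝ) : ℂ) * I)) by
      push_cast; ring, exp_neg, e1, inv_I]
  obtain ⟨t, -, ht⟩ := intermediate_value_Icc (by linarith [Real.pi_pos]) hg
    (show (0 : ℝ) ∈ Set.Icc (g (-(Real.pi / 2))) (g (Real.pi / 2)) by
      constructor
      · simp only [g, e2]; simp; linarith
      · simp only [g, e1]; simp; linarith)
  set e : ℂ := exp (t * I) with he
  have hen : ‖e‖ = 1 := norm_exp_ofReal_mul_I t
  have he0 : e ≠ 0 := exp_ne_zero _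
  have hec : (starRingEnd ℂ) e = e⁻¹ := by
    apply eq_inv_of_mul_eq_one_left
    rw [conj_mul', hen]; simp
  have hsin : (Real.sin t : ℂ) = (e - e⁻¹) / (2 * I) := by
    have : Real.sin t = e.im := by rw [he, exp_ofReal_mul_I_im]
    rw [this, im_eq_sub_conj, hec]
  have he3 : exp (-(3 * t * I)) = (e⁻¹) ^ 3 := by
    rw [he, ← exp_neg, ← exp_nat_mul]
    congr 1
    push_cast
    ring
  have him : ((a * exp (-(3 * t * I))).im : ℂ) =
      (a * (e⁻¹) ^ 3 - (starRingEnd ℂ) a * e ^ 3) / (2 * I) := by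
    rw [im_eq_sub_conj, he3, map_mul, map_pow, map_inv₀, hec, inv_inv]
  have hz : a * (e⁻¹) ^ 3 - (starRingEnd ℂ) a * e ^ 3 + (e - e⁻¹) = 0 := by
    have h : ((g t : ℝ) : ℂ) = 0 := by rw [ht]; rfl
    simp only [g, ofReal_add] at h
    rw [him, hsin, ← add_div, div_eq_zero_iff] at h
    simpa using h
  have hz' : e ^ 4 + a = e ^ 2 * (1 + (starRingEnd ℂ) a * e ^ 4) := by
    field_simp at hz
    linear_combination hz
  have hp : ‖e ^ 4‖ = 1 := by rw [norm_pow, hen, one_pow]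
  refine ⟨e ^ 4, hp, ?_⟩
  rw [IsFixedPt, blaschkeSq, hz', mul_div_cancel_right₀ _ (one_add_conj_mul_ne_zero ha hp.le)]
  ring

/-- If the cardioid value is at least one, the parameters can be chosen so that the
distinguished boundary fixed point is non-repelling. -/
lemma exists_param_three_le {a : ℂ} (ha : ‖a‖ < 1) (hQ : 1 ≤ cardioidValue a) :
    ∃ s b : ℝ, 3 ≤ s ∧ a = paramCoeff s b := by
  obtain ⟨p, hp, hfix⟩ := exists_isFixedPt_sphere ha
  obtain ⟨s, b, hs, rfl, -⟩ := exists_param ha hp hfix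
  rcases le_or_gt 3 s with h3 | h3
  · exact ⟨s, b, h3, rfl⟩
  have hN : 0 < s ^ 2 + b ^ 2 := by positivity
  have hD : 0 ≤ b ^ 2 + (s - 1) * (s - 3) := by
    have h := cardioidValue_paramCoeff (b := b) hs
    have h' : 0 ≤ 16 * (s - 3) ^ 2 * (b ^ 2 + (s - 1) * (s - 3)) / (s ^ 2 + b ^ 2) ^ 2 := by
      linarith
    rw [le_div_iff₀ (by positivity), zero_mul] at h'
    have h3' : s - 3 ≠ 0 := by linarith
    exact nonneg_of_mul_nonneg_right h' (by positivity)
  have hr := Real.sq_sqrt hD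
  have hr0 := Real.sqrt_nonneg (b ^ 2 + (s - 1) * (s - 3))
  set r := Real.sqrt (b ^ 2 + (s - 1) * (s - 3)) with hrdef
  have h3' : 0 < 3 - s := by linarith
  -- The real root of larger modulus: `s - 1 ≤ b * x` in the quadratic gives `s - 1 ≤ (3 - s)x²`,
  -- which says that the multiplier at `x` is at most one.
  obtain ⟨x, hx, hbx⟩ : ∃ x : ℝ, (s - 3) * x ^ 2 + 2 * b * x - (s - 1) = 0 ∧ s - 1 ≤ b * x := by
    rcases le_total 0 b with hb | hb
    · refine ⟨(b + r) / (3 - s), ?_, ?_⟩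
      · field_simp
        linear_combination (s - 3) * hr
      · rw [mul_div_assoc', le_div_iff₀ h3']
        nlinarith [mul_nonneg hb hr0]
    · refine ⟨(b - r) / (3 - s), ?_, ?_⟩
      · field_simp
        linear_combination (s - 3) * hr
      · rw [mul_div_assoc', le_div_iff₀ h3']
        nlinarith [mul_nonneg (neg_nonneg.2 hb) hr0]
  have hx0 : x ≠ 0 := by
    rintro rfl
    linarith
  have hfix' : IsFixedPt (blaschkeSq (paramCoeff s b)) (toDisk s b x) := by
    rw [isFixedPt_toDisk_iff hs (by simp)]
    exact_mod_cast hx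
  have hder := norm_deriv_toDisk_ofReal hs hx
  have hle : (s - 1) / 2 * (1 + 1 / x ^ 2) ≤ 1 := by
    have hx2 : 0 < x ^ 2 := by positivity
    rw [show (s - 1) / 2 * (1 + 1 / x ^ 2) = (s - 1) * (x ^ 2 + 1) / (2 * x ^ 2) by field_simp,
      div_le_one (by positivity)]
    nlinarith
  -- Reparametrizing at this fixed point makes its multiplier `2 / (s' - 1)`, so `3 ≤ s'`.
  obtain ⟨s', b', hs', h1, h2⟩ := exists_param ha (norm_toDisk_ofReal hs x) hfix'
  refine ⟨s', b', ?_, h1⟩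
  rw [← hder, h2, h1, norm_deriv_paramFixedPt hs', div_le_one (by linarith)] at hle
  linarith

/-! ### Escape to infinity in the half-plane. -/

lemma im_le_im_halfPlaneMap {s b : ℝ} (hs : 3 ≤ s) {w : ℂ} (hw : 0 < w.im) :
    w.im + w.im / normSq w ≤ (halfPlaneMap s b w).im := by
  rw [im_halfPlaneMap]
  have h : 0 ≤ w.im + w.im / normSq w := by
    have := normSq_nonneg w
    positivity
  nlinarith

/-- The orbits in the half-plane model tend to infinity if the multiplier at infinity is at
most one. -/
lemma tendsto_normSq_iterate_halfPlaneMap {s b : ℝ} (hs : 3 ≤ s) {w : ℂ} (hw : 0 < w.im) :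
    Tendsto (fun n => normSq ((halfPlaneMap s b)^[n] w)) atTop atTop := by
  set W : ℕ → ℂ := fun n => (halfPlaneMap s b)^[n] w with hW
  have hsucc : ∀ n, W (n + 1) = halfPlaneMap s b (W n) := fun n => iterate_succ_apply' _ _ _
  have hpos : ∀ n, 0 < (W n).im := fun n => by
    induction n with
    | zero => exact hw
    | succ n ih => rw [hsucc]; exact im_halfPlaneMap_pos (by linarith) ih
  have hstep : ∀ n, (W n).im + (W n).im / normSq (W n) ≤ (W (n + 1)).im := fun n => by
    rw [hsucc]; exact im_le_im_halfPlaneMap hs (hpos n)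
  have hns : ∀ n, 0 < normSq (W n) := fun n => normSq_pos.2 (by
    intro h
    have := hpos n
    rw [h] at this
    simp at this)
  have hmono : Monotone (fun n => (W n).im) := monotone_nat_of_le_succ fun n => by
    have := hstep n
    have := div_pos (hpos n) (hns n)
    linarith
  have hlow : ∀ n, w.im ≤ (W n).im := fun n => hmono (Nat.zero_le n)
  -- The heights increase. If they stay bounded, their increments tend to zero; these dominate `w.im
  -- / normSq (W n)`, so the orbit still escapes, horizontally.
  rcases tendsto_atTop_of_monotone hmono with h | ⟨l, hl⟩
  · have h2 : Tendsto (fun n => (W n).im ^ 2) atTop atTop :=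
      (tendsto_pow_atTop two_ne_zero).comp h
    refine tendsto_atTop_mono (fun n => ?_) h2
    rw [normSq_apply]
    nlinarith [mul_self_nonneg (W n).re]
  · have hdiff : Tendsto (fun n => ((W (n + 1)).im - (W n).im) / w.im) atTop (nhds 0) := by
      have := ((hl.comp (tendsto_add_atTop_nat 1)).sub hl).div_const w.im
      simpa using this
    have hinv : Tendsto (fun n => (normSq (W n))⁻¹) atTop (nhds 0) := by
      refine squeeze_zero (fun n => (inv_pos.2 (hns n)).le) (fun n => ?_) hdiff
      rw [le_div_iff₀ hw]
      have h1 := hstep n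
      have h2 : (normSq (W n))⁻¹ * w.im ≤ (normSq (W n))⁻¹ * (W n).im :=
        mul_le_mul_of_nonneg_left (hlow n) (inv_pos.2 (hns n)).le
      rw [div_eq_inv_mul] at h1
      linarith
    have := (tendsto_nhdsWithin_iff.2 ⟨hinv, Eventually.of_forall fun n => inv_pos.2 (hns n)⟩)
    exact this.inv_tendsto_nhdsGT_zero.congr fun n => by simp [hW]

lemma iterate_blaschkeSq_toDisk {s b : ℝ} (hs : 1 < s) {w : ℂ} (hw : 0 < w.im) (n : ℕ) :
    0 < ((halfPlaneMap s b)^[n] w).im ∧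
      (blaschkeSq (paramCoeff s b))^[n] (toDisk s b w) = toDisk s b ((halfPlaneMap s b)^[n] w) := by
  induction n with
  | zero => exact ⟨hw, rfl⟩
  | succ n ih =>
    simp only [iterate_succ_apply']
    exact ⟨im_halfPlaneMap_pos hs ih.1, by rw [ih.2, blaschkeSq_toDisk_eq hs ih.1]⟩

lemma iteratesTendstoOnDisk_paramFixedPt {s b : ℝ} (hs : 3 ≤ s) :
    IteratesTendstoOnDisk (blaschkeSq (paramCoeff s b)) (paramFixedPt s b) := by
  have hs1 : 1 < s := by linarith
  have ha := norm_paramCoeff_lt_one (b := b) hs1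
  refine iteratesTendstoOnDisk_of_pointwise (fun z hz =>
    (differentiableAt_blaschkeSq ha (by simpa using (mem_ball_zero_iff.1 hz).le)
      ).differentiableWithinAt) (mapsTo_blaschkeSq ha) fun z hz => ?_
  obtain ⟨w, hw, rfl⟩ := exists_toDisk_eq_of_norm_lt (b := b) hs1 (mem_ball_zero_iff.1 hz)
  have h1 : Tendsto (fun n => ‖(halfPlaneMap s b)^[n] w‖) atTop atTop := by
    have := Real.tendsto_sqrt_atTop.comp (tendsto_normSq_iterate_halfPlaneMap (b := b) hs hw)
    refine this.congr fun n => ?_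
    simp [normSq_eq_norm_sq]
  have h2 : Tendsto (fun n => ‖(halfPlaneMap s b)^[n] w - (b - (s - 1) * I)‖) atTop atTop := by
    refine tendsto_atTop_mono (fun n => norm_sub_norm_le _ _) ?_
    exact tendsto_atTop_add_const_right _ _ h1
  rw [tendsto_iff_norm_sub_tendsto_zero]
  refine (h2.const_div_atTop ‖-(2 * (s - 1) * I : ℂ)‖).congr fun n => ?_
  obtain ⟨him, heq⟩ := iterate_blaschkeSq_toDisk (b := b) hs1 hw n
  rw [heq, toDisk_sub (im_sub_ne_zero hs1 him.le), norm_mul, norm_paramFixedPt hs1, one_mul,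
    norm_div]

/-! ### Contraction towards an interior fixed point. -/

/-- Disk automorphisms preserve the pseudo-hyperbolic distance. -/
lemma norm_moebius_sub_mul {a z α : ℂ} (ha : ‖a‖ < 1) (hz : ‖z‖ < 1) (hα : ‖α‖ < 1) :
    ‖(z + a) / (1 + (starRingEnd ℂ) a * z) - (α + a) / (1 + (starRingEnd ℂ) a * α)‖ *
        ‖1 - (starRingEnd ℂ) α * z‖ =
      ‖z - α‖ * ‖1 - (starRingEnd ℂ) ((α + a) / (1 + (starRingEnd ℂ) a * α)) *
        ((z + a) / (1 + (starRingEnd ℂ) a * z))‖ := by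
  have h1 := one_add_conj_mul_ne_zero ha hz.le
  have h2 := one_add_conj_mul_ne_zero ha hα.le
  have e1 : (z + a) / (1 + (starRingEnd ℂ) a * z) - (α + a) / (1 + (starRingEnd ℂ) a * α) =
      (1 - (starRingEnd ℂ) a * a) * (z - α) /
        ((1 + (starRingEnd ℂ) a * z) * (1 + (starRingEnd ℂ) a * α)) := by
    rw [div_sub_div _ _ h1 h2]
    congr 1
    ring
  have h3 : 1 + a * (starRingEnd ℂ) α ≠ 0 := by
    have := (map_ne_zero (starRingEnd ℂ)).2 h2
    simpa using this
  have e2 : 1 - (starRingEnd ℂ) ((α + a) / (1 + (starRingEnd ℂ) a * α)) *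
        ((z + a) / (1 + (starRingEnd ℂ) a * z)) =
      (1 - (starRingEnd ℂ) a * a) * (1 - (starRingEnd ℂ) α * z) /
        ((1 + (starRingEnd ℂ) a * z) * (starRingEnd ℂ) (1 + (starRingEnd ℂ) a * α)) := by
    simp only [map_div₀, map_add, map_mul, map_one, conj_conj]
    rw [div_mul_div_comm, one_sub_div (mul_ne_zero h3 h1),
      div_eq_div_iff (mul_ne_zero h3 h1) (mul_ne_zero h1 h3)]
    ring
  rw [e1, e2, norm_div, norm_div, norm_mul, norm_mul, norm_mul, norm_mul, norm_conj]
  ring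

/-- The factor by which the Blaschke product contracts the pseudo-hyperbolic distance to a
fixed point `α`. -/
noncomputable def contractionFactor (a α z : ℂ) : ℝ :=
  ‖((z + a) / (1 + (starRingEnd ℂ) a * z) + (α + a) / (1 + (starRingEnd ℂ) a * α)) /
    (1 + (starRingEnd ℂ) ((α + a) / (1 + (starRingEnd ℂ) a * α)) *
      ((z + a) / (1 + (starRingEnd ℂ) a * z)))‖

lemma contractionFactor_lt_one {a α z : ℂ} (ha : ‖a‖ < 1) (hα : ‖α‖ < 1) (hz : ‖z‖ < 1) :
    contractionFactor a α z < 1 :=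
  norm_moebius_lt_one (norm_moebius_lt_one ha hα) (norm_moebius_lt_one ha hz)

/-- Let `v`, `β` be the Möbius images of `z`, `α`, so that `β² = α`. Then `v² - α = (v - β)(v + β)`,
and the denominator factors likewise: the factor with `v - β` is the invariant distance, the other
is `contractionFactor`. -/
lemma norm_blaschkeSq_sub_div {a α z : ℂ} (ha : ‖a‖ < 1) (hα : ‖α‖ < 1) (hz : ‖z‖ < 1)
    (hfix : IsFixedPt (blaschkeSq a) α) :
    ‖(blaschkeSq a z + -α) / (1 + (starRingEnd ℂ) (-α) * blaschkeSq a z)‖ =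
      ‖(z + -α) / (1 + (starRingEnd ℂ) (-α) * z)‖ * contractionFactor a α z := by
  have key := norm_moebius_sub_mul ha hz hα
  have hv := norm_moebius_lt_one ha hz
  have hβ := norm_moebius_lt_one ha hα
  have hα2 : ((α + a) / (1 + (starRingEnd ℂ) a * α)) ^ 2 = α := hfix
  have hα' : ‖-α‖ < 1 := by rwa [norm_neg]
  have n1 := norm_ne_zero_iff.2 (one_add_conj_mul_ne_zero hα' hz.le)
  rw [contractionFactor, blaschkeSq]
  generalize (z + a) / (1 + (starRingEnd ℂ) a * z) = v at *
  generalize (α + a) / (1 + (starRingEnd ℂ) a * α) = β at *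
  have hβ' : ‖-β‖ < 1 := by rwa [norm_neg]
  have n2 := norm_ne_zero_iff.2 (one_add_conj_mul_ne_zero hβ hv.le)
  have n3 := norm_ne_zero_iff.2 (one_add_conj_mul_ne_zero hβ' hv.le)
  have e1 : v ^ 2 + -α = (v - β) * (v + β) := by rw [← hα2]; ring
  have e2 : 1 + (starRingEnd ℂ) (-α) * v ^ 2 =
      (1 + (starRingEnd ℂ) (-β) * v) * (1 + (starRingEnd ℂ) β * v) := by
    rw [← hα2]; simp only [map_neg, map_pow]; ring
  have e3 : ∀ x y : ℂ, 1 + (starRingEnd ℂ) (-x) * y = 1 - (starRingEnd ℂ) x * y := by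
    intro x y; simp only [map_neg]; ring
  rw [e1, e2]
  simp only [norm_div, norm_mul]
  rw [mul_div_mul_comm]
  congr 1
  rw [div_eq_div_iff n3 n1, e3, e3, key, ← sub_eq_add_neg]

lemma continuousOn_moebius {a : ℂ} (ha : ‖a‖ < 1) :
    ContinuousOn (fun z : ℂ => (z + a) / (1 + (starRingEnd ℂ) a * z)) (ball 0 1) := by
  refine ContinuousOn.div (by fun_prop) (by fun_prop) fun z hz => ?_
  exact one_add_conj_mul_ne_zero ha (mem_ball_zero_iff.1 hz).le

lemma mapsTo_moebius {a : ℂ} (ha : ‖a‖ < 1) :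
    Set.MapsTo (fun z : ℂ => (z + a) / (1 + (starRingEnd ℂ) a * z)) (ball 0 1) (ball 0 1) :=
  fun _ hz => mem_ball_zero_iff.2 (norm_moebius_lt_one ha (mem_ball_zero_iff.1 hz))

lemma continuousOn_contractionFactor {a α : ℂ} (ha : ‖a‖ < 1) (hα : ‖α‖ < 1) :
    ContinuousOn (contractionFactor a α) (ball 0 1) :=
  ((continuousOn_moebius (norm_moebius_lt_one ha hα)).comp (continuousOn_moebius ha)
    (mapsTo_moebius ha)).norm

lemma moebius_neg_moebius {α z : ℂ} (hα : ‖α‖ < 1) (hz : ‖z‖ < 1) :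
    ((z + -α) / (1 + (starRingEnd ℂ) (-α) * z) + α) /
      (1 + (starRingEnd ℂ) α * ((z + -α) / (1 + (starRingEnd ℂ) (-α) * z))) = z := by
  have hα' : ‖-α‖ < 1 := by rwa [norm_neg]
  have h1 := one_add_conj_mul_ne_zero hα' hz.le
  have h2 := one_add_conj_mul_ne_zero hα (norm_moebius_lt_one hα' hz).le
  rw [div_eq_iff h2, map_neg]
  rw [map_neg] at h1
  generalize hd : 1 + -(starRingEnd ℂ) α * z = d at *
  field_simp
  rw [← hd]
  ring

/-- Iterates converge to a fixed point in the disk. -/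
lemma iteratesTendstoOnDisk_of_isFixedPt {a α : ℂ} (ha : ‖a‖ < 1) (hα : ‖α‖ < 1)
    (hfix : IsFixedPt (blaschkeSq a) α) : IteratesTendstoOnDisk (blaschkeSq a) α := by
  refine iteratesTendstoOnDisk_of_pointwise (fun z hz =>
    (differentiableAt_blaschkeSq ha (by simpa using (mem_ball_zero_iff.1 hz).le)
      ).differentiableWithinAt) (mapsTo_blaschkeSq ha) fun z hz => ?_
  have hα' : ‖-α‖ < 1 := by rwa [norm_neg]
  set m : ℂ → ℝ := fun z => ‖(z + -α) / (1 + (starRingEnd ℂ) (-α) * z)‖ with hm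
  have hm0 : ∀ z, 0 ≤ m z := fun z => norm_nonneg _
  have hm1 : m z < 1 := norm_moebius_lt_one hα' (mem_ball_zero_iff.1 hz)
  -- The closed pseudo-hyperbolic disk about `α` through `z`. It is compact and contains the orbit,
  -- so the maximum of `contractionFactor` on it is a uniform rate below one.
  set S : Set ℂ :=
    Set.image (fun y : ℂ => (y + α) / (1 + (starRingEnd ℂ) α * y)) (closedBall 0 (m z)) with hS
  have hsub : closedBall (0 : ℂ) (m z) ⊆ ball 0 1 := closedBall_subset_ball hm1
  have hSc : IsCompact S :=
    (isCompact_closedBall 0 (m z)).image_of_continuousOn ((continuousOn_moebius hα).mono hsub)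
  have hSD : S ⊆ ball 0 1 := by
    rintro _ ⟨y, hy, rfl⟩
    exact mapsTo_moebius hα (hsub hy)
  have hmem : ∀ y ∈ ball (0 : ℂ) 1, m y ≤ m z → y ∈ S := fun y hy h =>
    ⟨_, mem_closedBall_zero_iff.2 h, moebius_neg_moebius hα (mem_ball_zero_iff.1 hy)⟩
  obtain ⟨q, hq, hmax⟩ := hSc.exists_isMaxOn ⟨z, hmem z hz le_rfl⟩
    ((continuousOn_contractionFactor ha hα).mono hSD)
  set κ := contractionFactor a α q with hκ
  have hκ0 : 0 ≤ κ := norm_nonneg _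
  have hκ1 : κ < 1 := contractionFactor_lt_one ha hα (mem_ball_zero_iff.1 (hSD hq))
  have hbound : ∀ n, m ((blaschkeSq a)^[n] z) ≤ κ ^ n * m z := fun n => by
    induction n with
    | zero => simp
    | succ n ih =>
      have hD : (blaschkeSq a)^[n] z ∈ ball (0 : ℂ) 1 := (mapsTo_blaschkeSq ha).iterate n hz
      have hle : m ((blaschkeSq a)^[n] z) ≤ m z :=
        ih.trans (mul_le_of_le_one_left (hm0 z) (pow_le_one₀ hκ0 hκ1.le))
      rw [iterate_succ_apply']
      calc m (blaschkeSq a ((blaschkeSq a)^[n] z))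
          = m ((blaschkeSq a)^[n] z) * contractionFactor a α ((blaschkeSq a)^[n] z) :=
            norm_blaschkeSq_sub_div ha hα (mem_ball_zero_iff.1 hD) hfix
        _ ≤ (κ ^ n * m z) * κ :=
            mul_le_mul ih (hmax (hmem _ hD hle)) (norm_nonneg _)
              (mul_nonneg (pow_nonneg hκ0 n) (hm0 z))
        _ = κ ^ (n + 1) * m z := by ring
  rw [tendsto_iff_norm_sub_tendsto_zero]
  have hlim : Tendsto (fun n : ℕ => κ ^ n * m z * 2) atTop (nhds 0) := by
    simpa using ((tendsto_pow_atTop_nhds_zero_of_lt_one hκ0 hκ1).mul_const (m z)).mul_const 2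
  refine squeeze_zero (fun n => norm_nonneg _) (fun n => ?_) hlim
  have hD : ‖(blaschkeSq a)^[n] z‖ < 1 :=
    mem_ball_zero_iff.1 ((mapsTo_blaschkeSq ha).iterate n hz)
  have hne := norm_pos_iff.2 (one_add_conj_mul_ne_zero hα' hD.le)
  have h2 : ‖1 + (starRingEnd ℂ) (-α) * (blaschkeSq a)^[n] z‖ ≤ 2 := by
    refine (norm_add_le _ _).trans ?_
    rw [norm_one, norm_mul, norm_conj]
    nlinarith [norm_nonneg (-α), norm_nonneg ((blaschkeSq a)^[n] z)]
  calc ‖(blaschkeSq a)^[n] z - α‖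
      = m ((blaschkeSq a)^[n] z) * ‖1 + (starRingEnd ℂ) (-α) * (blaschkeSq a)^[n] z‖ := by
        rw [hm]
        simp only [norm_div]
        rw [div_mul_cancel₀ _ hne.ne', sub_eq_add_neg]
    _ ≤ (κ ^ n * m z) * 2 := mul_le_mul (hbound n) h2 hne.le
        (mul_nonneg (pow_nonneg hκ0 n) (hm0 z))

/-- A second fixed point would have its distance to `α` strictly contracted and yet preserved. -/
lemma eq_of_isFixedPt_ball {a α z : ℂ} (ha : ‖a‖ < 1) (hα : ‖α‖ < 1) (hz : ‖z‖ < 1)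
    (hfix : IsFixedPt (blaschkeSq a) α) (hfix' : IsFixedPt (blaschkeSq a) z) : z = α := by
  have hα' : ‖-α‖ < 1 := by rwa [norm_neg]
  have h := norm_blaschkeSq_sub_div ha hα hz hfix
  rw [hfix'.eq] at h
  have h1 := contractionFactor_lt_one ha hα hz
  have h2 : ‖(z + -α) / (1 + (starRingEnd ℂ) (-α) * z)‖ = 0 := by nlinarith
  rw [norm_eq_zero, div_eq_zero_iff] at h2
  rcases h2 with h2 | h2
  · linear_combination h2
  · exact absurd h2 (one_add_conj_mul_ne_zero hα' hz.le)

/-! ### The fixed-point cubic and multiplicities. -/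

/-- Fixed points are the roots of a cubic polynomial. -/
lemma isFixedPt_blaschkeSq_iff {a z : ℂ} (hz : 1 + (starRingEnd ℂ) a * z ≠ 0) :
    IsFixedPt (blaschkeSq a) z ↔ (starRingEnd ℂ) a ^ 2 * z ^ 3 + (2 * (starRingEnd ℂ) a - 1) * z ^ 2
      + (1 - 2 * a) * z + -a ^ 2 = 0 := by
  rw [IsFixedPt, blaschkeSq, div_pow, div_eq_iff (pow_ne_zero 2 hz)]
  constructor <;> intro h <;> linear_combination -h

/-- If there is no fixed point in the disk, all roots of the fixed point polynomial lie on the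
circle, by reflection. -/
lemma norm_eq_one_of_cubic_eq_zero {a z : ℂ} (ha : ‖a‖ < 1)
    (hno : ∀ z ∈ ball (0 : ℂ) 1, ¬ IsFixedPt (blaschkeSq a) z)
    (hz : (starRingEnd ℂ) a ^ 2 * z ^ 3 + (2 * (starRingEnd ℂ) a - 1) * z ^ 2
      + (1 - 2 * a) * z + -a ^ 2 = 0) : ‖z‖ = 1 := by
  rcases lt_trichotomy ‖z‖ 1 with h | h | h
  · exact absurd ((isFixedPt_blaschkeSq_iff (one_add_conj_mul_ne_zero ha h.le)).2 hz)
      (hno z (mem_ball_zero_iff.2 h))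
  · exact h
  · exfalso
    have hz0 : z ≠ 0 := by rintro rfl; simp at h; linarith
    have hc0 : (starRingEnd ℂ) z ≠ 0 := (map_ne_zero _).2 hz0
    have h' : ‖((starRingEnd ℂ) z)⁻¹‖ < 1 := by
      rw [norm_inv, norm_conj]
      exact inv_lt_one_of_one_lt₀ h
    refine hno _ (mem_ball_zero_iff.2 h')
      ((isFixedPt_blaschkeSq_iff (one_add_conj_mul_ne_zero ha h'.le)).2 ?_)
    -- Reversing and conjugating the coefficients of the cubic changes only its sign, so its roots
    -- are symmetric in the circle.
    have hc := congrArg (starRingEnd ℂ) hz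
    simp only [map_add, map_mul, map_sub, map_pow, map_neg, conj_conj, map_one, map_zero,
      map_ofNat] at hc
    field_simp
    linear_combination -hc

lemma exists_cubic_roots {a : ℂ} (ha : a ≠ 0) :
    ∃ z₁ z₂ z₃ : ℂ, ∀ z, (starRingEnd ℂ) a ^ 2 * z ^ 3 + (2 * (starRingEnd ℂ) a - 1) * z ^ 2
      + (1 - 2 * a) * z + -a ^ 2 = (starRingEnd ℂ) a ^ 2 * ((z - z₁) * (z - z₂) * (z - z₃)) := by
  let P : Cubic ℂ := ⟨(starRingEnd ℂ) a ^ 2, 2 * (starRingEnd ℂ) a - 1, 1 - 2 * a, -a ^ 2⟩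
  have hP : P.a ≠ 0 := pow_ne_zero 2 ((map_ne_zero _).2 ha)
  obtain ⟨x, y, z, h⟩ := (Cubic.splits_iff_roots_eq_three (φ := RingHom.id ℂ) hP).1
    (IsAlgClosed.splits _)
  have hb := Cubic.b_eq_three_roots hP h
  have hc := Cubic.c_eq_three_roots hP h
  have hd := Cubic.d_eq_three_roots hP h
  simp only [P, RingHom.id_apply] at hb hc hd
  exact ⟨x, y, z, fun w => by linear_combination w ^ 2 * hb + w * hc + hd⟩

lemma analyticOrderAt_sub_const (c z : ℂ) [Decidable (z = c)] :
    analyticOrderAt (fun w : ℂ => w - c) z = if z = c then 1 else 0 := by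
  split_ifs with h
  · subst h
    exact analyticOrderAt_id_sub_const_self
  · exact analyticOrderAt_id_sub_const_of_ne h

-- For `a ≠ 0` the cubic has degree three, and all its roots lie on the circle. Near the circle
-- `B(w) - w` is the cubic times a nonvanishing analytic function, so the orders add up to the
-- number of roots.
open Classical in
lemma finsum_fixedPtMultiplicity {a : ℂ} (ha : ‖a‖ < 1) (ha0 : a ≠ 0)
    (hno : ∀ z ∈ ball (0 : ℂ) 1, ¬ IsFixedPt (blaschkeSq a) z) :
    ∑ᶠ z ∈ sphere (0 : ℂ) 1, fixedPtMultiplicity (blaschkeSq a) z = 3 := by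
  obtain ⟨z₁, z₂, z₃, hroots⟩ := exists_cubic_roots ha0
  have hn : ∀ c, c = z₁ ∨ c = z₂ ∨ c = z₃ → ‖c‖ = 1 := fun c hc => by
    refine norm_eq_one_of_cubic_eq_zero ha hno ?_
    rw [hroots]
    rcases hc with rfl | rfl | rfl <;> ring
  have hmult : ∀ z ∈ sphere (0 : ℂ) 1, fixedPtMultiplicity (blaschkeSq a) z =
      (if z = z₁ then 1 else 0) + (if z = z₂ then 1 else 0) + (if z = z₃ then 1 else 0) := by
    intro z hz
    have hne := one_add_conj_mul_ne_zero ha (mem_sphere_zero_iff_norm.1 hz).le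
    have hev : (fun w => blaschkeSq a w - w) =ᶠ[nhds z]
        (fun w => -(starRingEnd ℂ) a ^ 2 / (1 + (starRingEnd ℂ) a * w) ^ 2) *
          ((fun w => w - z₁) * (fun w => w - z₂) * (fun w => w - z₃)) := by
      have hcont : ContinuousAt (fun w : ℂ => 1 + (starRingEnd ℂ) a * w) z := by fun_prop
      filter_upwards [hcont.eventually_ne hne] with w hw
      have h := hroots w
      simp only [Pi.mul_apply, blaschkeSq]
      rw [div_pow, div_sub' (pow_ne_zero 2 hw), div_mul_eq_mul_div]
      congr 1
      linear_combination -h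
    have hA : AnalyticAt ℂ (fun w => -(starRingEnd ℂ) a ^ 2 / (1 + (starRingEnd ℂ) a * w) ^ 2) z := by
      refine AnalyticAt.div (by fun_prop) (by fun_prop) (pow_ne_zero 2 hne)
    have hL : ∀ c : ℂ, AnalyticAt ℂ (fun w : ℂ => w - c) z := fun c => by fun_prop
    rw [fixedPtMultiplicity, analyticOrderNatAt, analyticOrderAt_congr hev,
      analyticOrderAt_mul hA (((hL _).mul (hL _)).mul (hL _)),
      analyticOrderAt_mul ((hL _).mul (hL _)) (hL _), analyticOrderAt_mul (hL _) (hL _),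
      hA.analyticOrderAt_eq_zero.2 (div_ne_zero (by simpa using ha0) (pow_ne_zero 2 hne)),
      analyticOrderAt_sub_const, analyticOrderAt_sub_const, analyticOrderAt_sub_const, zero_add]
    split_ifs <;> rfl
  have hsub : (Function.support fun z => ∑ᶠ _ : z ∈ sphere (0 : ℂ) 1,
      fixedPtMultiplicity (blaschkeSq a) z) ⊆ (({z₁, z₂, z₃} : Finset ℂ) : Set ℂ) := by
    intro z hz
    by_contra hcon
    apply hz
    by_cases hzs : z ∈ sphere (0 : ℂ) 1
    · simp only [hzs, finsum_true, hmult z hzs]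
      simp at hcon
      simp [hcon]
    · simp only [hzs, finsum_false]
  rw [finsum_eq_sum_of_support_subset _ hsub]
  have hS : ∀ z ∈ ({z₁, z₂, z₃} : Finset ℂ), (∑ᶠ _ : z ∈ sphere (0 : ℂ) 1,
      fixedPtMultiplicity (blaschkeSq a) z) =
      (if z = z₁ then 1 else 0) + (if z = z₂ then 1 else 0) + (if z = z₃ then 1 else 0) := by
    intro z hz
    have hzs : z ∈ sphere (0 : ℂ) 1 := mem_sphere_zero_iff_norm.2 (hn z (by simpa using hz))
    simp only [hzs, finsum_true, hmult z hzs]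
  rw [Finset.sum_congr rfl hS, Finset.sum_add_distrib, Finset.sum_add_distrib,
    Finset.sum_ite_eq', Finset.sum_ite_eq', Finset.sum_ite_eq']
  simp

/-! ### Fixed points counted in the half-plane coordinate. -/

section
variable {s b : ℝ}

/-- Fixed points on the circle other than the distinguished one are the real roots of a
quadratic polynomial. -/
lemma isFixedPt_sphere_iff (hs : 1 < s) {z : ℂ} (hz : ‖z‖ = 1) :
    IsFixedPt (blaschkeSq (paramCoeff s b)) z ↔ z = paramFixedPt s b ∨
      ∃ x : ℝ, (s - 3) * x ^ 2 + 2 * b * x - (s - 1) = 0 ∧ z = toDisk s b x := by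
  have hreal (x : ℝ) : IsFixedPt (blaschkeSq (paramCoeff s b)) (toDisk s b x) ↔
      (s - 3) * x ^ 2 + 2 * b * x - (s - 1) = 0 := by
    rw [isFixedPt_toDisk_iff hs (by simp)]
    exact_mod_cast Iff.rfl
  constructor
  · intro h
    by_cases hzp : z = paramFixedPt s b
    · exact Or.inl hzp
    · obtain ⟨x, rfl⟩ := exists_toDisk_eq_of_norm_eq hs hz hzp
      exact Or.inr ⟨x, (hreal x).1 h, rfl⟩
  · rintro (rfl | ⟨x, hx, rfl⟩)
    · exact isFixedPt_paramFixedPt hs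
    · exact (hreal x).2 hx

/-- For `w` in the upper half-plane, the imaginary part of the quadratic gives `(s - 3) Re w + b =
0`; the real part then becomes `(s - 3)|w|² + (s - 1) = 0`, which is impossible. The degenerate case
`s = 3` is included. -/
lemma not_isFixedPt_of_three_le (hs : 3 ≤ s) {z : ℂ} (hz : ‖z‖ < 1) :
    ¬ IsFixedPt (blaschkeSq (paramCoeff s b)) z := by
  have hs1 : 1 < s := by linarith
  obtain ⟨w, hw, rfl⟩ := exists_toDisk_eq_of_norm_lt (b := b) hs1 hz
  rw [isFixedPt_toDisk_iff hs1 hw.le]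
  intro h
  have hre := congrArg re h
  have him := congrArg im h
  simp [pow_two] at hre him
  have him' : (s - 3) * w.re + b = 0 := by
    have : 2 * w.im * ((s - 3) * w.re + b) = 0 := by linear_combination him
    simpa [hw.ne'] using this
  have key : (s - 3) * (w.re ^ 2 + w.im ^ 2) + (s - 1) = 0 := by
    linear_combination 2 * w.re * him' - hre
  linarith [mul_nonneg (sub_nonneg.2 hs) (add_nonneg (sq_nonneg w.re) (sq_nonneg w.im))]

lemma one_lt_norm_deriv_of_three_le (hs : 3 ≤ s) {x : ℝ}
    (hx : (s - 3) * x ^ 2 + 2 * b * x - (s - 1) = 0) :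
    1 < ‖deriv (blaschkeSq (paramCoeff s b)) (toDisk s b x)‖ := by
  have hx0 : x ≠ 0 := by
    rintro rfl
    simp at hx
    linarith
  rw [norm_deriv_toDisk_ofReal (by linarith) hx]
  have : 0 < 1 / x ^ 2 := by positivity
  nlinarith

lemma one_lt_cardioidValue_iff (hs : 3 ≤ s) : 1 < cardioidValue (paramCoeff s b) ↔ 3 < s := by
  have h := cardioidValue_paramCoeff (b := b) (s := s) (by linarith)
  constructor
  · intro hQ
    rcases hs.eq_or_lt with rfl | h3
    · norm_num at h
      linarith
    · exact h3
  · intro h3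
    have h0 : 0 < s - 3 := by linarith
    have h1 : 0 < s - 1 := by linarith
    have : 0 < 16 * (s - 3) ^ 2 * (b ^ 2 + (s - 1) * (s - 3)) / (s ^ 2 + b ^ 2) ^ 2 := by
      positivity
    linarith

lemma ncard_isFixedPt_sphere (hs : 3 < s) :
    {z ∈ sphere (0 : ℂ) 1 | IsFixedPt (blaschkeSq (paramCoeff s b)) z}.ncard = 3 := by
  have hs1 : 1 < s := by linarith
  have h3 : 0 < s - 3 := by linarith
  have h1 : 0 < s - 1 := by linarith
  have hD : 0 < b ^ 2 + (s - 1) * (s - 3) := by positivity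
  have hr := Real.sq_sqrt hD.le
  have hr0 := Real.sqrt_pos.2 hD
  set r := Real.sqrt (b ^ 2 + (s - 1) * (s - 3))
  have hd : ∀ x : ℝ, (x : ℂ) - (b - (s - 1) * I) ≠ 0 := fun x => im_sub_ne_zero hs1 (by simp)
  have hroot (x : ℝ) : (s - 3) * x ^ 2 + 2 * b * x - (s - 1) = 0 ↔
      x = (-b + r) / (s - 3) ∨ x = (-b - r) / (s - 3) := by
    rw [eq_div_iff h3.ne', eq_div_iff h3.ne']
    constructor
    · intro h
      have : (x * (s - 3) - (-b + r)) * (x * (s - 3) - (-b - r)) = 0 := by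
        linear_combination (s - 3) * h - hr
      rcases mul_eq_zero.1 this with h | h
      · left; linarith
      · right; linarith
    · intro h
      apply mul_left_cancel₀ h3.ne'
      rcases h with h | h
      · linear_combination (x * (s - 3) + b + r) * h + hr
      · linear_combination (x * (s - 3) + b - r) * h + hr
  have hset : {z ∈ sphere (0 : ℂ) 1 | IsFixedPt (blaschkeSq (paramCoeff s b)) z} =
      {paramFixedPt s b, toDisk s b (((-b + r) / (s - 3) : ℝ) : ℂ),
        toDisk s b (((-b - r) / (s - 3) : ℝ) : ℂ)} := by
    ext z
    simp only [Set.mem_ofPred_eq, mem_sphere_zero_iff_norm, Set.mem_insert_iff,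
      Set.mem_singleton_iff]
    constructor
    · rintro ⟨hz, h⟩
      rcases (isFixedPt_sphere_iff hs1 hz).1 h with h | ⟨x, hx, rfl⟩
      · exact Or.inl h
      · rcases (hroot x).1 hx with rfl | rfl
        · exact Or.inr (Or.inl rfl)
        · exact Or.inr (Or.inr rfl)
    · rintro (rfl | rfl | rfl)
      · exact ⟨norm_paramFixedPt hs1, isFixedPt_paramFixedPt hs1⟩
      all_goals
        have hz := norm_toDisk_ofReal (b := b) hs1
        refine ⟨hz _, (isFixedPt_sphere_iff hs1 (hz _)).2 (Or.inr ⟨_, (hroot _).2 ?_, rfl⟩)⟩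
        simp
  rw [hset, Set.ncard_eq_three]
  refine ⟨_, _, _, (toDisk_ne hs1 (hd _)).symm, (toDisk_ne hs1 (hd _)).symm, fun h => ?_, rfl⟩
  have h' := ofReal_injective (toDisk_injOn hs1 (hd _) (hd _) h)
  rw [div_left_inj' h3.ne'] at h'
  linarith

end

theorem mainTheorem5 (a : ℂ) (ha : ‖a‖ < 1) :
    (cardioidValue a < 1 →
      ∃ α ∈ ball (0 : ℂ) 1, ∃ β ∈ sphere (0 : ℂ) 1,
        (∀ z ∈ ball (0 : ℂ) 1, IsFixedPt (blaschkeSq a) z ↔ z = α) ∧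
        (∀ z ∈ sphere (0 : ℂ) 1, IsFixedPt (blaschkeSq a) z ↔ z = β) ∧
        IsAttractingFixedPt (blaschkeSq a) α ∧
        ¬ IsAttractingFixedPt (blaschkeSq a) β ∧
        IteratesTendstoOnDisk (blaschkeSq a) α) ∧
    (1 ≤ cardioidValue a →
      (∀ z ∈ ball (0 : ℂ) 1, ¬ IsFixedPt (blaschkeSq a) z) ∧
      (∑ᶠ z ∈ sphere (0 : ℂ) 1, fixedPtMultiplicity (blaschkeSq a) z) = 3 ∧
      (1 < cardioidValue a →
        {z ∈ sphere (0 : ℂ) 1 | IsFixedPt (blaschkeSq a) z}.ncard = 3) ∧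
      ∃ p ∈ sphere (0 : ℂ) 1,
        (∀ z ∈ sphere (0 : ℂ) 1, IsNonrepellingFixedPt (blaschkeSq a) z ↔ z = p) ∧
        (IsAttractingFixedPt (blaschkeSq a) p ↔ 1 < cardioidValue a) ∧
        IteratesTendstoOnDisk (blaschkeSq a) p) := by
  constructor
  · intro hQ
    obtain ⟨p, hp, hfix⟩ := exists_isFixedPt_sphere ha
    obtain ⟨s, b, hs, rfl, rfl⟩ := exists_param ha hp hfix
    have hD : b ^ 2 + (s - 1) * (s - 3) < 0 := by
      by_contra! hcon
      have h := cardioidValue_paramCoeff (b := b) hs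
      have : 0 ≤ 16 * (s - 3) ^ 2 * (b ^ 2 + (s - 1) * (s - 3)) / (s ^ 2 + b ^ 2) ^ 2 := by
        positivity
      linarith
    have h3 : s < 3 := by nlinarith [sq_nonneg b]
    have h3' : 0 < 3 - s := by linarith
    have hr := Real.sq_sqrt (neg_pos.2 hD).le
    have hr0 := Real.sqrt_pos.2 (neg_pos.2 hD)
    set r := Real.sqrt (-(b ^ 2 + (s - 1) * (s - 3)))
    -- The root `(b + ir)/(3 - s)` of the quadratic, in the upper half-plane because `D < 0` forces
    -- `s < 3`.
    have hw : (0 : ℝ) < (⟨b / (3 - s), r / (3 - s)⟩ : ℂ).im := div_pos hr0 h3'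
    have hα := norm_toDisk_lt_one (b := b) hs hw
    have hαfix : IsFixedPt (blaschkeSq (paramCoeff s b))
        (toDisk s b ⟨b / (3 - s), r / (3 - s)⟩) := by
      rw [isFixedPt_toDisk_iff hs hw.le]
      apply Complex.ext
      · simp [pow_two]
        field_simp
        linear_combination (3 - s) * hr
      · simp [pow_two]
        field_simp
        ring
    generalize toDisk s b ⟨b / (3 - s), r / (3 - s)⟩ = α at *
    refine ⟨α, mem_ball_zero_iff.2 hα, paramFixedPt s b, mem_sphere_zero_iff_norm.2 hp,
      fun z hz => ⟨fun h => eq_of_isFixedPt_ball ha hα (mem_ball_zero_iff.1 hz) hαfix h,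
        fun h => h ▸ hαfix⟩, fun z hz => ?_,
      ⟨differentiableAt_blaschkeSq ha hα.le, hαfix, norm_deriv_blaschkeSq_lt_one ha hα hαfix⟩,
      fun h => ?_, iteratesTendstoOnDisk_of_isFixedPt ha hα hαfix⟩
    · rw [isFixedPt_sphere_iff hs (mem_sphere_zero_iff_norm.1 hz), or_iff_left]
      rintro ⟨x, hx, -⟩
      -- Multiplied by `s - 3`, the quadratic is `((s - 3)x + b)² - D`, which is positive.
      nlinarith [sq_nonneg ((s - 3) * x + b)]
    · have h' := h.2.2
      rw [norm_deriv_paramFixedPt hs, div_lt_one (by linarith)] at h'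
      linarith
  · intro hQ
    have ha0 : a ≠ 0 := by
      rintro rfl
      norm_num [cardioidValue] at hQ
    obtain ⟨s, b, hs, rfl⟩ := exists_param_three_le ha hQ
    have hs1 : 1 < s := by linarith
    have hno : ∀ z ∈ ball (0 : ℂ) 1, ¬ IsFixedPt (blaschkeSq (paramCoeff s b)) z :=
      fun z hz => not_isFixedPt_of_three_le hs (mem_ball_zero_iff.1 hz)
    have hp := norm_paramFixedPt (b := b) hs1
    have hpd := differentiableAt_blaschkeSq ha hp.le
    have hpf := isFixedPt_paramFixedPt (b := b) hs1
    have hder := norm_deriv_paramFixedPt (b := b) hs1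
    refine ⟨hno, finsum_fixedPtMultiplicity ha ha0 hno, fun h =>
      ncard_isFixedPt_sphere ((one_lt_cardioidValue_iff hs).1 h), paramFixedPt s b,
      mem_sphere_zero_iff_norm.2 hp, fun z hz => ⟨fun h => ?_, ?_⟩, ?_,
      iteratesTendstoOnDisk_paramFixedPt hs⟩
    · rcases (isFixedPt_sphere_iff hs1 (mem_sphere_zero_iff_norm.1 hz)).1 h.2.1 with
        h' | ⟨x, hx, rfl⟩
      · exact h'
      · exact absurd h.2.2 (not_le.2 (one_lt_norm_deriv_of_three_le hs hx))
    · rintro rfl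
      exact ⟨hpd, hpf, by rw [hder, div_le_one (by linarith)]; linarith⟩
    · rw [one_lt_cardioidValue_iff hs]
      have hlt : 2 / (s - 1) < 1 ↔ 3 < s := by
        rw [div_lt_one (by linarith)]
        constructor <;> intro h <;> linarith
      rw [← hlt, ← hder]
      exact ⟨fun h => h.2.2, fun h => ⟨hpd, hpf, h⟩⟩
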